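/- Let $n \ge 0$ and let $R_n$ be the set of rooks of size $n$, that is, of words $r = r_1 r_2 \cdots r_n$ with letters in $\{0,1,\dots,n\}$ in which every nonzero letter occurs at most once. For $1 \le k < n$ let $\pi_k$ act on the right on $R_n$ by exchanging $r_k$ and $r_{k+1}$ if $r_k < r_{k+1}$ and by fixing $r$ otherwise, and (for $n\ge 1$) let $P_1$ act by replacing the first letter $r_1$ by $0$. Let $R_n^0$ be the monoid of functions on $R_n$ generated by $\pi_1,\dots,\pi_{n-1},P_1$ (the $0$-rook monoid), and order $R_n$ by the $\mathcal{R}$-order: $r \le_{\mathcal R} u$ if and only if $r = u\cdot \pi$ for some $\pi \in R_n^0$; the largest element is the identity rook $12\cdots n$. Call $z \in R_n$ meet-irreducible if it is not the largest element and if, whenever $z$ is the meet (greatest lower bound) of $z_1$ and $z_2$, one has $z_1 = z$ or $z_2 = z$. For $n \ge 1$ let $p(r)$ be the first letter $r_1$ of $r$ if it is nonzero, and $1$ if it is zero. Then, for $n\ge 1$ and $1 \le i \le n$, the number of meet-irreducible $r \in R_n$ with $p(r) = i$ is $3^{n-i}\,2^{i-1}$. Consequently, for every $n \ge 0$, the total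 number of meet-irreducible elements of $R_n$ is $3^n - 2^n$. -/

import Mathlib

/-- A rook of size `n`, in one-line notation: a word of length `n` over `{0, …, n}` in which every
nonzero letter occurs at most once.  The letter at position `j` is the row index of the `1` in the
`j`-th column of the rook matrix, or `0` if that column is zero. Positions are indexed by `Fin n`,
so the first letter is at position `0`. -/
@[ext]
structure Rook (n : ℕ) where
  letter : Fin n → Fin (n + 1)
  inj : ∀ i j, letter i ≠ 0 → letter i = letter j → i = j

namespace Rook

variable {n : ℕ}

/-- The rook obtained by exchanging the letters at positions `i` and `j`. -/
def swap (i j : Fin n) (r : Rook n) : Rook n where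
  letter a := r.letter (Equiv.swap i j a)
  inj _ _ h hab := (Equiv.swap i j).injective (r.inj _ _ h hab)

/-- The rook obtained by replacing the letter at position `i` by `0`. -/
def kill (i : Fin n) (r : Rook n) : Rook n where
  letter a := if a = i then 0 else r.letter a
  inj a b h hab := by
    by_cases ha : a = i
    · simp [ha] at h
    · by_cases hb : b = i
      · simp only [ha, hb, if_true, if_false] at h hab
        exact absurd hab h
      · simp only [ha, hb, if_false] at h hab
        exact r.inj a b h hab

/-- The action of the generator `π` exchanging the adjacent positions `k` and `k + 1` (counted from
`0`): it exchanges the two letters if they are in increasing order and does nothing otherwise. -/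
def sortDesc (k : ℕ) (hk : k + 1 < n) (r : Rook n) : Rook n :=
  if r.letter ⟨k, by omega⟩ < r.letter ⟨k + 1, hk⟩ then
    swap ⟨k, by omega⟩ ⟨k + 1, hk⟩ r
  else r

/-- The `0`-rook monoid: the monoid of functions on rooks generated by the operators
`π_1, …, π_{n-1}` and `P_1` (the latter replaces the first letter by `0`). It acts on the right, so
the product is composition in the opposite order. -/
def zeroRookMonoid (n : ℕ) : Submonoid (Function.End (Rook n))ᵐᵒᵖ :=
  Submonoid.closure
    ({f | ∃ (k : ℕ) (hk : k + 1 < n), f = MulOpposite.op (sortDesc k hk)} ∪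
      {f | ∃ h0 : 0 < n, f = MulOpposite.op (kill ⟨0, h0⟩)})

/-- The right action of an operator on a rook. -/
def act (u : Rook n) (f : (Function.End (Rook n))ᵐᵒᵖ) : Rook n := f.unop u

/-- A weight that every generator decreases strictly on the rooks that it does not fix. It is only
used to see that the `R`-preorder below is antisymmetric. -/
def weight (r : Rook n) : ℕ := ∑ i : Fin n, ((i : ℕ) + 1) * (r.letter i : ℕ)

theorem weight_kill (i : Fin n) (r : Rook n) :
    kill i r = r ∨ weight (kill i r) < weight r := by
  by_cases h : r.letter i = 0
  · left
    ext a
    by_cases ha : a = i <;> simp [kill, ha, h]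
  · right
    refine Finset.sum_lt_sum (fun a _ => ?_) ⟨i, Finset.mem_univ _, ?_⟩
    · by_cases ha : a = i <;> simp [kill, ha]
    · have : 0 < (r.letter i : ℕ) := Nat.pos_of_ne_zero fun h' => h (Fin.ext h')
      simp only [kill, if_true, Fin.val_zero, mul_zero]
      positivity

theorem weight_sortDesc (k : ℕ) (hk : k + 1 < n) (r : Rook n) :
    sortDesc k hk r = r ∨ weight (sortDesc k hk r) < weight r := by
  by_cases h : r.letter ⟨k, by omega⟩ < r.letter ⟨k + 1, hk⟩
  · right
    have hne : (⟨k, by omega⟩ : Fin n) ≠ ⟨k + 1, hk⟩ := by simp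
    have hrest : ∀ s : Rook n, weight s =
        (k + 1) * (s.letter ⟨k, by omega⟩ : ℕ) + (k + 1 + 1) * (s.letter ⟨k + 1, hk⟩ : ℕ) +
        ∑ i ∈ (Finset.univ.erase (⟨k, by omega⟩ : Fin n)).erase ⟨k + 1, hk⟩,
          ((i : ℕ) + 1) * (s.letter i : ℕ) := by
      intro s
      rw [weight, ← Finset.add_sum_erase _ _ (Finset.mem_univ (⟨k, by omega⟩ : Fin n)),
        ← Finset.add_sum_erase _ _ (Finset.mem_erase.2 ⟨hne.symm, Finset.mem_univ _⟩)]
      exact (add_assoc _ _ _).symm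
    rw [hrest, hrest r]
    have hsum : ∑ i ∈ (Finset.univ.erase (⟨k, by omega⟩ : Fin n)).erase ⟨k + 1, hk⟩,
          ((i : ℕ) + 1) * ((sortDesc k hk r).letter i : ℕ) =
        ∑ i ∈ (Finset.univ.erase (⟨k, by omega⟩ : Fin n)).erase ⟨k + 1, hk⟩,
          ((i : ℕ) + 1) * (r.letter i : ℕ) := by
      refine Finset.sum_congr rfl fun i hi => ?_
      simp only [Finset.mem_erase] at hi
      simp [sortDesc, h, swap, Equiv.swap_apply_of_ne_of_ne hi.2.1 hi.1]
    rw [hsum]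
    have h' : (r.letter ⟨k, by omega⟩ : ℕ) < r.letter ⟨k + 1, hk⟩ := h
    simp only [sortDesc, h, if_true, swap, Equiv.swap_apply_left, Equiv.swap_apply_right]
    nlinarith
  · left
    simp [sortDesc, h]

theorem weight_act {f : (Function.End (Rook n))ᵐᵒᵖ} (hf : f ∈ zeroRookMonoid n) (u : Rook n) :
    act u f = u ∨ weight (act u f) < weight u := by
  induction hf using Submonoid.closure_induction generalizing u with
  | mem f hf =>
    rcases hf with ⟨k, hk, rfl⟩ | ⟨h0, rfl⟩
    · exact weight_sortDesc k hk u
    · exact weight_kill _ u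
  | one => exact Or.inl rfl
  | mul f g _ _ ihf ihg =>
    have e : act u (f * g) = act (act u f) g := rfl
    rw [e]
    rcases ihf u with h1 | h1
    · rw [h1]
      exact ihg u
    · rcases ihg (act u f) with h2 | h2
      · rw [h2]
        exact Or.inr h1
      · exact Or.inr (h2.trans h1)

/-- The `R`-order on rooks: `r ≤ u` if and only if `r = u · π` for some `π` in the `0`-rook
monoid. The identity rook is the largest element. -/
instance : PartialOrder (Rook n) where
  le r u := ∃ f ∈ zeroRookMonoid n, r = act u f
  le_refl r := ⟨1, one_mem _, rfl⟩
  le_trans r s t := by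
    rintro ⟨f, hf, rfl⟩ ⟨g, hg, rfl⟩
    exact ⟨g * f, mul_mem hg hf, rfl⟩
  le_antisymm r s := by
    rintro ⟨f, hf, hr⟩ ⟨g, hg, hs⟩
    rcases weight_act hf s with h1 | h1
    · rw [hr, h1]
    · rcases weight_act hg r with h2 | h2
      · rw [hs, h2]
      · rw [← hr] at h1
        rw [← hs] at h2
        exact absurd h1 h2.asymm

/-- The first letter of a nonempty rook if it is nonzero, and `1` otherwise. -/
def p (hn : 0 < n) (r : Rook n) : ℕ :=
  if r.letter ⟨0, hn⟩ = 0 then 1 else r.letter ⟨0, hn⟩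

end Rook

/-- `z` is meet irreducible: it is not the largest element, and whenever `z` is the meet (the
greatest lower bound) of `x` and `y`, one of `x` and `y` is equal to `z`. In a lattice this is
`InfIrred z`. -/
def MeetIrreducible {α : Type*} [PartialOrder α] (z : α) : Prop :=
  ¬ IsMax z ∧ ∀ x y : α, IsGLB {x, y} z → x = z ∨ y = z

/-!
The order is studied through the words of rooks. A nontrivial generator either exchanges an ascent
`r_k < r_{k+1}` or replaces a nonzero first letter by `0` (`Step`), and `w ≤ u` means that `w` is
reached from `u` by such steps.

Two facts about words control the order. First, there is a monotone invariant: if `w ≤ u`, then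
every nonzero letter of `w` occurs in `u`, and it is followed in `w` by at least as many copies of
any smaller letter (zero included) as in `u` (`exists_word_eq`). Secondly, there is a converse for
one step, the lifting property `le_of_step_all`: if `w ≤ u`, and if the invariant does not forbid
that `w` lies below the result of a given step out of `u`, then `w` does lie below it. It is proved
by well-founded induction on `u`, comparing the given step with the first step of a path from `u`
to `w` through the commutation, braid and absorption relations between the generators.

Consequently two different sources of steps to `z` have the meet `z` (`le_of_le_of_le`), so `z` is
meet irreducible if and only if exactly one step leads to `z`. Steps to `z` correspond to the
descents of `z` and, if `z` begins with `0`, to the missing letters. Hence the meet irreducible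
rooks are of two kinds (`meetIrreducible_iff`): those with nonzero first letter and exactly one
descent, and those with first letter `0`, no descent and exactly one missing letter.

For the count, cut a word with at most one descent at a position `d` so that both pieces increase
weakly and the first contains no `0`. Such a pair is determined by the distribution of the letters
`1, …, n` among the first piece, the second piece and the missing letters, and every distribution
occurs (`TwoRuns.eq_of_distr_eq`, `exists_twoRuns`). The rooks of the first kind thus account for
all distributions with a nonempty first piece, except for the `n` cuts of the identity rook, and
these are matched with the `n` rooks of the second kind. Under this matching `p` becomes the
smallest letter `i` of the first piece, so that each of the `i - 1` smaller letters has two classes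
to choose from and each of the `n - i` larger letters has three.
-/

namespace Rook

variable {n : ℕ}

/-! ### Words and generators -/

/-- The word of a rook as a function on all natural numbers, with the letter `0` at the positions
outside the word. -/
def word (r : Rook n) (i : ℕ) : ℕ := if h : i < n then (r.letter ⟨i, h⟩ : ℕ) else 0

theorem word_of_lt (r : Rook n) {i : ℕ} (h : i < n) : r.word i = r.letter ⟨i, h⟩ := dif_pos h

theorem word_of_le (r : Rook n) {i : ℕ} (h : n ≤ i) : r.word i = 0 := dif_neg h.not_gt

theorem word_le (r : Rook n) (i : ℕ) : r.word i ≤ n := by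
  rw [word]
  split_ifs
  · exact Nat.lt_succ_iff.1 (Fin.is_lt _)
  · exact n.zero_le

theorem lt_of_word_ne_zero {r : Rook n} {i : ℕ} (h : r.word i ≠ 0) : i < n := by
  by_contra hi
  exact h (r.word_of_le (not_lt.1 hi))

theorem word_inj {r : Rook n} {i j : ℕ} (h : r.word i ≠ 0) (e : r.word i = r.word j) : i = j := by
  have hi := lt_of_word_ne_zero h
  have hj := lt_of_word_ne_zero (e ▸ h)
  rw [r.word_of_lt hi] at h e
  rw [r.word_of_lt hj] at e
  simpa using r.inj _ _ (fun h' => h (by simp [h'])) (Fin.ext e)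

theorem ext_word {r s : Rook n} (h : ∀ i, r.word i = s.word i) : r = s := by
  ext i
  have := h i
  rwa [r.word_of_lt i.2, s.word_of_lt i.2] at this

/-- The rook obtained by exchanging the letters at the positions `k` and `k + 1`. -/
def exch (k : ℕ) (r : Rook n) : Rook n :=
  if h : k + 1 < n then swap ⟨k, by omega⟩ ⟨k + 1, h⟩ r else r

/-- The rook obtained by replacing the first letter by `0`. -/
def killFirst (r : Rook n) : Rook n := if h : 0 < n then kill ⟨0, h⟩ r else r

theorem word_exch {k : ℕ} (hk : k + 1 < n) (r : Rook n) (i : ℕ) :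
    (exch k r).word i =
      if i = k then r.word (k + 1) else if i = k + 1 then r.word k else r.word i := by
  have hk' : k < n := by omega
  by_cases hi : i < n
  · rw [exch, dif_pos hk, word_of_lt _ hi]
    simp only [swap]
    split_ifs with h1 h2
    · subst h1
      rw [Equiv.swap_apply_left, word_of_lt _ hk]
    · subst h2
      rw [Equiv.swap_apply_right, word_of_lt _ hk']
    · rw [Equiv.swap_apply_of_ne_of_ne (by simpa using h1) (by simpa using h2), word_of_lt _ hi]
  · rw [if_neg (by omega), if_neg (by omega), word_of_le _ (not_lt.1 hi),
      word_of_le _ (not_lt.1 hi)]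

theorem word_exch_left {k : ℕ} (hk : k + 1 < n) (r : Rook n) :
    (exch k r).word k = r.word (k + 1) := by
  simp [word_exch hk]

theorem word_exch_right {k : ℕ} (hk : k + 1 < n) (r : Rook n) :
    (exch k r).word (k + 1) = r.word k := by
  simp [word_exch hk]

theorem word_exch_of_ne {k : ℕ} (hk : k + 1 < n) (r : Rook n) {i : ℕ} (h1 : i ≠ k)
    (h2 : i ≠ k + 1) : (exch k r).word i = r.word i := by
  simp [word_exch hk, h1, h2]

theorem word_killFirst (r : Rook n) (i : ℕ) :
    (killFirst r).word i = if i = 0 then 0 else r.word i := by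
  by_cases hi : i < n
  · rw [killFirst, dif_pos (by omega), word_of_lt _ hi, word_of_lt _ hi]
    simp only [kill, Fin.mk.injEq]
    split_ifs <;> rfl
  · rw [word_of_le _ (not_lt.1 hi), word_of_le _ (not_lt.1 hi), ite_self]

theorem lt_of_ascent {r : Rook n} {k : ℕ} (h : r.word k < r.word (k + 1)) : k + 1 < n :=
  lt_of_word_ne_zero (r := r) (by omega)

theorem exch_exch (k : ℕ) (r : Rook n) : exch k (exch k r) = r := by
  by_cases hk : k + 1 < n
  · refine ext_word fun i => ?_
    simp only [word_exch hk]
    split_ifs <;> first | omega | simp_all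
  · simp [exch, hk]

theorem exch_comm {j k : ℕ} (hjk : j + 1 < k ∨ k + 1 < j) (hj : j + 1 < n) (hk : k + 1 < n)
    (r : Rook n) : exch k (exch j r) = exch j (exch k r) := by
  refine ext_word fun i => ?_
  simp only [word_exch hk, word_exch hj]
  split_ifs <;> first | rfl | omega

theorem exch_braid {k : ℕ} (hk : k + 2 < n) (r : Rook n) :
    exch (k + 1) (exch k (exch (k + 1) r)) = exch k (exch (k + 1) (exch k r)) := by
  refine ext_word fun i => ?_
  simp only [word_exch hk, word_exch (by omega : k + 1 < n)]
  split_ifs <;> first | rfl | omega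

theorem killFirst_exch {k : ℕ} (h0 : k ≠ 0) (hk : k + 1 < n) (r : Rook n) :
    killFirst (exch k r) = exch k (killFirst r) := by
  refine ext_word fun i => ?_
  simp only [word_exch hk, word_killFirst]
  split_ifs <;> first | rfl | omega | contradiction

/-- Both sides replace the first two letters by `0`. -/
theorem killFirst_exch_killFirst (hn : 0 + 1 < n) (r : Rook n) :
    killFirst (exch 0 (killFirst (exch 0 r))) = killFirst (exch 0 (killFirst r)) := by
  refine ext_word fun i => ?_
  simp only [word_exch hn, word_killFirst]
  split_ifs <;> rfl

/-! ### The order through steps -/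

/-- A generator of the monoid acting nontrivially on `u`, with result `v`. -/
inductive Step : Rook n → Rook n → Prop
  | exch (u : Rook n) (k : ℕ) (h : u.word k < u.word (k + 1)) : Step u (exch k u)
  | kill (u : Rook n) (h : u.word 0 ≠ 0) : Step u (killFirst u)

theorem sortDesc_of_ascent {u : Rook n} {k : ℕ} (hk : k + 1 < n)
    (h : u.word k < u.word (k + 1)) : sortDesc k hk u = exch k u := by
  rw [word_of_lt _ hk, word_of_lt _ (by omega : k < n)] at h
  rw [sortDesc, if_pos (Fin.lt_def.2 h), exch, dif_pos hk]

theorem sortDesc_of_not_ascent {u : Rook n} {k : ℕ} (hk : k + 1 < n)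
    (h : ¬ u.word k < u.word (k + 1)) : sortDesc k hk u = u := by
  rw [word_of_lt _ hk, word_of_lt _ (by omega : k < n)] at h
  rw [sortDesc, if_neg (fun h' => h (Fin.lt_def.1 h'))]

theorem exch_le {u : Rook n} {k : ℕ} (h : u.word k < u.word (k + 1)) : exch k u ≤ u := by
  have hk := lt_of_ascent h
  exact ⟨_, Submonoid.subset_closure (Or.inl ⟨k, hk, rfl⟩), (sortDesc_of_ascent hk h).symm⟩

theorem killFirst_le (u : Rook n) : killFirst u ≤ u := by
  rw [killFirst]
  split_ifs with hn
  · exact ⟨_, Submonoid.subset_closure (Or.inr ⟨hn, rfl⟩), rfl⟩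
  · exact le_rfl

theorem Step.lt {u v : Rook n} (h : Step u v) : v < u := by
  cases h with
  | exch k h =>
    refine lt_of_le_of_ne (exch_le h) fun e => ?_
    have := congrArg (fun r => word r k) e
    simp only [word_exch (lt_of_ascent h), if_true] at this
    omega
  | kill h =>
    refine lt_of_le_of_ne (killFirst_le u) fun e => h ?_
    rw [← e, word_killFirst, if_pos rfl]

theorem killFirst_eq_self {u : Rook n} (h : u.word 0 = 0) : killFirst u = u := by
  refine ext_word fun i => ?_
  rw [word_killFirst]
  split_ifs with hi
  · rw [hi, h]
  · rfl

open Relation in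
theorem le_iff_reflTransGen {w u : Rook n} : w ≤ u ↔ ReflTransGen Step u w := by
  constructor
  · rintro ⟨f, hf, rfl⟩
    induction hf using Submonoid.closure_induction generalizing u with
    | mem f hf =>
      rcases hf with ⟨k, hk, rfl⟩ | ⟨h0, rfl⟩
      · change ReflTransGen Step u (sortDesc k hk u)
        by_cases h : u.word k < u.word (k + 1)
        · rw [sortDesc_of_ascent hk h]
          exact ReflTransGen.single (Step.exch u k h)
        · rw [sortDesc_of_not_ascent hk h]
      · have e : Rook.kill ⟨0, h0⟩ u = killFirst u := by rw [killFirst, dif_pos h0]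
        change ReflTransGen Step u (Rook.kill ⟨0, h0⟩ u)
        rw [e]
        by_cases h : u.word 0 = 0
        · rw [killFirst_eq_self h]
        · exact ReflTransGen.single (Step.kill u h)
    | one => exact ReflTransGen.refl
    | mul f g _ _ ihf ihg => exact ihf.trans ihg
  · intro h
    induction h with
    | refl => exact le_rfl
    | tail _ h ih => exact h.lt.le.trans ih

instance : Finite (Rook n) := by
  refine Finite.of_injective (letter : Rook n → Fin n → Fin (n + 1)) fun r s h => ?_
  ext i
  rw [h]

/-! ### The invariant counting smaller letters -/

/-- The number of occurrences of the letter `a` after position `i`. -/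
def after (r : Rook n) (i a : ℕ) : ℕ :=
  ((Finset.range n).filter fun j => i < j ∧ r.word j = a).card

theorem after_anti (r : Rook n) {i j : ℕ} (h : i ≤ j) (a : ℕ) : r.after j a ≤ r.after i a := by
  refine Finset.card_le_card fun l hl => ?_
  simp only [Finset.mem_filter] at hl ⊢
  exact ⟨hl.1, by omega, hl.2.2⟩

theorem exists_of_after_pos {r : Rook n} {i a : ℕ} (h : 0 < r.after i a) :
    ∃ j, i < j ∧ r.word j = a := by
  obtain ⟨j, hj⟩ := Finset.card_pos.1 h
  exact ⟨j, (Finset.mem_filter.1 hj).2⟩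

theorem after_eq_succ (r : Rook n) {i : ℕ} (hi : i + 1 < n) (a : ℕ) :
    r.after i a = r.after (i + 1) a + if r.word (i + 1) = a then 1 else 0 := by
  have key : ∀ j, (i < j ∧ r.word j = a) ↔
      (i + 1 < j ∧ r.word j = a) ∨ (j = i + 1 ∧ r.word (i + 1) = a) := by
    intro j
    constructor
    · rintro ⟨h1, h2⟩
      rcases (Nat.succ_le_of_lt h1).lt_or_eq with h | h
      · exact Or.inl ⟨h, h2⟩
      · exact Or.inr ⟨h.symm, by rwa [← Nat.succ_eq_add_one, h]⟩
    · rintro (⟨h1, h2⟩ | ⟨rfl, h2⟩)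
      · exact ⟨by omega, h2⟩
      · exact ⟨by omega, h2⟩
  simp only [after, key]
  rw [Finset.filter_or, Finset.card_union_of_disjoint]
  · congr 1
    split_ifs with h
    · rw [Finset.card_eq_one]
      refine ⟨i + 1, ?_⟩
      ext j
      simp only [Finset.mem_filter, Finset.mem_range, Finset.mem_singleton, h, and_true]
      omega
    · simp [h]
  · rw [Finset.disjoint_filter]
    omega

theorem after_killFirst (r : Rook n) (i a : ℕ) : (killFirst r).after i a = r.after i a := by
  simp only [after]
  congr 1
  refine Finset.filter_congr fun j _ => and_congr_right fun h => ?_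
  rw [word_killFirst, if_neg (by omega)]

theorem after_exch {k : ℕ} (hk : k + 1 < n) (r : Rook n) {i : ℕ} (hi : i ≠ k) (a : ℕ) :
    (exch k r).after i a = r.after i a := by
  have hw : ∀ j, (exch k r).word j = r.word (Equiv.swap k (k + 1) j) := by
    intro j
    rw [word_exch hk, Equiv.swap_apply_def]
    split_ifs <;> rfl
  refine Finset.card_equiv (Equiv.swap k (k + 1)) fun j => ?_
  simp only [Finset.mem_filter, Finset.mem_range, hw]
  rw [Equiv.swap_apply_def]
  split_ifs <;> omega

theorem Step.after_le {u v : Rook n} (h : Step u v) {i : ℕ} (hi : v.word i ≠ 0) :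
    ∃ j, u.word j = v.word i ∧ ∀ a < v.word i, u.after j a ≤ v.after i a := by
  cases h with
  | exch k h =>
    have hk := lt_of_ascent h
    by_cases h1 : i = k
    · subst h1
      refine ⟨i + 1, by simp [word_exch hk], fun a _ => ?_⟩
      rw [← after_exch hk u (by omega : i + 1 ≠ i)]
      exact after_anti _ (by omega) _
    by_cases h2 : i = k + 1
    · subst h2
      have e : (Rook.exch k u).word (k + 1) = u.word k := by simp [word_exch hk]
      refine ⟨k, e.symm, fun a ha => ?_⟩
      rw [e] at ha
      rw [after_exch hk u (by omega : k + 1 ≠ k), after_eq_succ u hk, if_neg (by omega)]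
      rfl
    · refine ⟨i, by simp [word_exch hk, h1, h2], fun a _ => ?_⟩
      rw [after_exch hk u h1]
  | kill h =>
    refine ⟨i, ?_, fun a _ => (after_killFirst u i a).ge⟩
    rw [word_killFirst] at hi ⊢
    split_ifs at hi ⊢
    · exact absurd rfl hi
    · rfl

/-- The invariant of the order. The letters of `w` occur in `u`, and each is followed by at least
as many copies of a smaller letter `a` as in `u`; for `a ≠ 0` this says that inversions persist. -/
theorem exists_word_eq {w u : Rook n} (h : w ≤ u) {i : ℕ} (hi : w.word i ≠ 0) :
    ∃ j, u.word j = w.word i ∧ ∀ a < w.word i, u.after j a ≤ w.after i a := by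
  rw [le_iff_reflTransGen] at h
  induction h generalizing i with
  | refl => exact ⟨i, rfl, fun _ _ => le_rfl⟩
  | tail _ h ih =>
    obtain ⟨j, hj, hj'⟩ := h.after_le hi
    obtain ⟨l, hl, hl'⟩ := ih (hj ▸ hi)
    exact ⟨l, hl.trans hj, fun a ha => (hl' a (hj ▸ ha)).trans (hj' a ha)⟩

theorem after_le_after {w u : Rook n} (h : w ≤ u) {i j a : ℕ} (e : w.word i = u.word j)
    (ha : a < u.word j) : u.after j a ≤ w.after i a := by
  obtain ⟨l, hl, hl'⟩ := exists_word_eq h (i := i) (by omega)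
  have : l = j := word_inj (r := u) (by omega) (by omega)
  subst this
  exact hl' a (by omega)

/-- An inversion of `u` stays an inversion below `u`, unless its larger letter disappears. -/
theorem exists_of_inversion {w u : Rook n} (h : w ≤ u) {i j k : ℕ} (e : w.word i = u.word j)
    (hjk : j < k) (hk : k < n) (hu : u.word k < u.word j) :
    ∃ l, i < l ∧ w.word l = u.word k := by
  refine exists_of_after_pos (lt_of_lt_of_le ?_ (after_le_after h e hu))
  exact Finset.card_pos.2 ⟨k, by simp [hk, hjk]⟩

/-! ### The lifting property -/

/-- The hypothesis on `w ≤ u` under which the ascent of `u` at `k` may be sorted without leaving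
the upper bounds of `w`. -/
def Sortable (w u : Rook n) (k : ℕ) : Prop :=
  u.word k < u.word (k + 1) ∧
    ∀ i, w.word i = u.word (k + 1) → u.after (k + 1) (u.word k) < w.after i (u.word k)

/-- The hypothesis on `w ≤ u` under which the first letter of `u` may be removed without leaving
the upper bounds of `w`. -/
def Killable (w u : Rook n) : Prop := ∀ i, w.word i ≠ 0 → w.word i ≠ u.word 0

/-- The lifting property: below the invariant, upper bounds of `w` may be moved down by one step.
Each case replays a relation between the generator in question and the first generator on a path
from `u` to `w`; the induction hypothesis applies to each intermediate rook. -/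
theorem le_of_step_all (u : Rook n) :
    ∀ w ≤ u, (∀ k, Sortable w u k → w ≤ exch k u) ∧ (Killable w u → w ≤ killFirst u) := by
  induction u using WellFoundedLT.induction with
  | ind u ih =>
  intro w hw
  rcases (le_iff_reflTransGen.1 hw).cases_head with rfl | ⟨u', hs, hw'⟩
  · refine ⟨fun k hk => absurd (hk.2 (k + 1) rfl) (lt_irrefl _), fun hk => ?_⟩
    rw [killFirst_eq_self]
    by_contra h
    exact hk 0 h rfl
  rw [← le_iff_reflTransGen] at hw'
  have hlt := hs.lt
  cases hs with
  | exch j hj =>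
    have hjn := lt_of_ascent hj
    refine ⟨fun k hk => ?_, fun hk => ?_⟩
    · obtain ⟨hk1, hk2⟩ := hk
      have hkn := lt_of_ascent hk1
      obtain rfl | hjk := eq_or_ne j k
      · exact hw'
      obtain rfl | hjk1 := eq_or_ne j (k + 1)
      · -- The letters `a < b < c` at `k`, `k + 1`, `k + 2` become `a c b`, `c a b`, `c b a`.
        set u' := Rook.exch (k + 1) u with hu'
        have e0 : u'.word k = u.word k := word_exch_of_ne hjn u (by omega) (by omega)
        have e1 : u'.word (k + 1) = u.word (k + 1 + 1) := word_exch_left hjn u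
        have e2 : u'.word (k + 1 + 1) = u.word (k + 1) := word_exch_right hjn u
        have s1 : Sortable w u' k := by
          refine ⟨by omega, fun i hi => ?_⟩
          obtain ⟨l, hl, hl'⟩ := exists_of_inversion hw' hi (Nat.lt_add_one _) hjn (by omega)
          have h1 := hk2 l (by rw [hl', ← e2])
          have h2 := w.after_anti hl.le (u.word k)
          have h3 := after_eq_succ u' hjn (u.word k)
          have h4 := after_eq_succ u hjn (u.word k)
          rw [if_neg (by omega)] at h3 h4
          rw [hu', after_exch hjn u (i := k + 1 + 1) (by omega), ← hu'] at h3
          rw [e0]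
          omega
        have hv := (ih u' hlt w hw').1 k s1
        have hvu := (exch_le s1.1).trans_lt hlt
        set v := Rook.exch k u' with hv'
        have f1 : v.word (k + 1) = u.word k := (word_exch_right hkn u').trans e0
        have f2 : v.word (k + 1 + 1) = u.word (k + 1) :=
          (word_exch_of_ne hkn u' (by omega) (by omega)).trans e2
        have s2 : Sortable w v (k + 1) := by
          refine ⟨by omega, fun i hi => ?_⟩
          have h1 := hk2 i (by omega)
          have h2 := u.after_anti (Nat.le_succ (k + 1)) (u.word k)
          rw [f1, hv', after_exch hkn u' (by omega), hu', after_exch hjn u (by omega)]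
          exact h2.trans_lt h1
        have hx := (ih v hvu w hv).1 (k + 1) s2
        rw [hv', hu', exch_braid hjn] at hx
        refine hx.trans ((exch_le ?_).trans (exch_le ?_))
        · rw [word_exch_left hjn, word_exch_of_ne hjn _ (by omega) (by omega), word_exch_left hkn,
            word_exch_of_ne hkn _ (by omega) (by omega)]
          exact hj
        · rw [word_exch_right hkn, word_exch_of_ne hkn _ (by omega) (by omega)]
          exact hk1.trans hj
      obtain rfl | hjk2 := eq_or_ne k (j + 1)
      · -- The letters `c < a < b` at `j`, `j + 1`, `j + 2` become `a c b`, `a b c`, `b a c`.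
        set u' := Rook.exch j u with hu'
        have e0 : u'.word j = u.word (j + 1) := word_exch_left hjn u
        have e1 : u'.word (j + 1) = u.word j := word_exch_right hjn u
        have e2 : u'.word (j + 1 + 1) = u.word (j + 1 + 1) :=
          word_exch_of_ne hjn u (by omega) (by omega)
        have s1 : Sortable w u' (j + 1) := by
          refine ⟨by omega, fun i hi => ?_⟩
          obtain ⟨l, hl, hl'⟩ := exists_of_after_pos (Nat.zero_lt_of_lt (hk2 i (by omega)))
          have h1 := after_le_after hw' (i := l) (j := j) (a := u.word j) (by omega) (by omega)
          have h2 := w.after_anti hl.le (u.word j)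
          have h3 := after_eq_succ u' hjn (u.word j)
          have h4 := u'.after_anti (Nat.le_succ (j + 1)) (u.word j)
          rw [if_pos e1] at h3
          rw [e1]
          simp only [Nat.succ_eq_add_one] at h4
          omega
        have hv := (ih u' hlt w hw').1 (j + 1) s1
        have hvu := (exch_le s1.1).trans_lt hlt
        set v := Rook.exch (j + 1) u' with hv'
        have f0 : v.word j = u.word (j + 1) :=
          (word_exch_of_ne hkn u' (by omega) (by omega)).trans e0
        have f1 : v.word (j + 1) = u.word (j + 1 + 1) := (word_exch_left hkn u').trans e2
        have f2 : v.word (j + 1 + 1) = u.word j := (word_exch_right hkn u').trans e1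
        have s2 : Sortable w v j := by
          refine ⟨by omega, fun i hi => ?_⟩
          have h1 := hk2 i (by omega)
          have h2 := after_eq_succ v hkn (u.word (j + 1))
          rw [if_neg (by omega), add_zero] at h2
          rw [f0, h2, hv', after_exch hkn u' (by omega), hu', after_exch hjn u (by omega)]
          exact h1
        have hx := (ih v hvu w hv).1 j s2
        rw [hv', hu', ← exch_braid hkn] at hx
        refine hx.trans ((exch_le ?_).trans (exch_le ?_))
        · rw [word_exch_right hjn, word_exch_of_ne hjn _ (by omega) (by omega),
            word_exch_of_ne hkn _ (by omega) (by omega), word_exch_right hkn]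
          exact hj
        · rw [word_exch_left hkn, word_exch_of_ne hkn _ (by omega) (by omega)]
          exact hj.trans hk1
      · have e0 : (Rook.exch j u).word k = u.word k := word_exch_of_ne hjn u (by omega) (by omega)
        have e1 : (Rook.exch j u).word (k + 1) = u.word (k + 1) :=
          word_exch_of_ne hjn u (by omega) (by omega)
        have hx := (ih _ hlt w hw').1 k ⟨by omega, fun i hi => by
          rw [e0, after_exch hjn u (by omega)]
          exact hk2 i (by omega)⟩
        rw [exch_comm (by omega) hjn hkn] at hx
        refine hx.trans (exch_le ?_)
        rw [word_exch_of_ne hkn u (by omega) (by omega),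
          word_exch_of_ne hkn u (by omega) (by omega)]
        exact hj
    · obtain rfl | hj0 := eq_or_ne j 0
      · by_cases ha : u.word 0 = 0
        · rwa [killFirst_eq_self ha]
        -- The letters `a < b` at the front become `b a`, `0 a`, `a 0`, `0 0`.
        set u' := Rook.exch 0 u with hu'
        have e0 : u'.word 0 = u.word (0 + 1) := word_exch_left hjn u
        have e1 : u'.word (0 + 1) = u.word 0 := word_exch_right hjn u
        have k1 : Killable w u' := fun i _ hi' => by
          obtain ⟨l, -, hl⟩ := exists_of_inversion hw' hi' (Nat.lt_add_one 0) hjn (by omega)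
          exact hk l (by omega) (by omega)
        have hv := (ih u' hlt w hw').2 k1
        have hvu := (killFirst_le u').trans_lt hlt
        set v := killFirst u' with hv'
        have f0 : v.word 0 = 0 := by rw [hv', word_killFirst, if_pos rfl]
        have f1 : v.word (0 + 1) = u.word 0 := by
          rw [hv', word_killFirst, if_neg (by omega), e1]
        have s1 : Sortable w v 0 :=
          ⟨by omega, fun i hi => absurd (hi.trans f1) (hk i (by omega))⟩
        have hx := (ih v hvu w hv).1 0 s1
        have k2 : Killable w (Rook.exch 0 v) := fun i hi hi' => by
          rw [word_exch_left hjn, f1] at hi'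
          exact hk i hi hi'
        have hy := (ih _ ((exch_le s1.1).trans_lt hvu) w hx).2 k2
        rw [hv', hu', killFirst_exch_killFirst hjn] at hy
        refine hy.trans ((killFirst_le _).trans (exch_le ?_))
        rw [word_killFirst, word_killFirst, if_pos rfl, if_neg (by omega)]
        omega
      · have hx := (ih _ hlt w hw').2 fun i hi => by
          rw [word_exch_of_ne hjn u (by omega) (by omega)]
          exact hk i hi
        rw [killFirst_exch hj0 hjn] at hx
        refine hx.trans (exch_le ?_)
        rwa [word_killFirst, word_killFirst, if_neg hj0, if_neg (by omega)]
  | kill h =>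
    refine ⟨fun k hk => ?_, fun _ => hw'⟩
    obtain ⟨hk1, hk2⟩ := hk
    have hkn := lt_of_ascent hk1
    have e1 : (killFirst u).word (k + 1) = u.word (k + 1) := by
      rw [word_killFirst, if_neg (by omega)]
    obtain rfl | hk0 := eq_or_ne k 0
    · -- The letters `a < b` at the front become `0 b`, `b 0`, `0 0`.
      have hb : ∀ i, w.word i ≠ u.word (0 + 1) := fun i hi => by
        obtain ⟨l, -, hl⟩ := exists_of_after_pos (Nat.zero_lt_of_lt (hk2 i hi))
        obtain ⟨m, hm, -⟩ := exists_word_eq hw' (i := l) (by omega)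
        rw [word_killFirst] at hm
        split_ifs at hm with hm0
        · omega
        · exact hm0 (word_inj (r := u) (by omega) (hm.trans hl))
      have e0 : (killFirst u).word 0 = 0 := by rw [word_killFirst, if_pos rfl]
      have s1 : Sortable w (killFirst u) 0 :=
        ⟨by omega, fun i hi => absurd (hi.trans e1) (hb i)⟩
      have hx := (ih _ hlt w hw').1 0 s1
      have hy := (ih _ ((exch_le s1.1).trans_lt hlt) w hx).2 fun i _ hi => by
        rw [word_exch_left hkn, e1] at hi
        exact hb i hi
      rw [← killFirst_exch_killFirst hkn] at hy
      refine hy.trans ((killFirst_le _).trans ((exch_le ?_).trans (killFirst_le _)))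
      rw [word_killFirst, word_killFirst, if_pos rfl, if_neg (by omega), word_exch_right hkn]
      omega
    · have e0 : (killFirst u).word k = u.word k := by rw [word_killFirst, if_neg hk0]
      have hx := (ih _ hlt w hw').1 k ⟨by omega, fun i hi => by
        rw [e0, after_killFirst]
        exact hk2 i (by omega)⟩
      rw [← killFirst_exch hk0 hkn] at hx
      exact hx.trans (killFirst_le _)

/-! ### Steps into a rook and meet irreducibility -/

/-- The word of `z` goes down from position `k` to position `k + 1`. -/
def Descent (z : Rook n) (k : ℕ) : Prop := k + 1 < n ∧ z.word (k + 1) < z.word k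

/-- The nonzero letter `a` does not occur in `z`. -/
def Missing (z : Rook n) (a : ℕ) : Prop := 0 < a ∧ a ≤ n ∧ ∀ i, z.word i ≠ a

theorem step_exch_of_descent {z : Rook n} {k : ℕ} (h : z.Descent k) : Step (exch k z) z := by
  have := Step.exch (exch k z) k (by
    rw [word_exch_left h.1, word_exch_right h.1]
    exact h.2)
  rwa [exch_exch] at this

theorem descent_of_ascent {c : Rook n} {k : ℕ} (h : c.word k < c.word (k + 1)) :
    (exch k c).Descent k := by
  have hk := lt_of_ascent h
  refine ⟨hk, ?_⟩
  rwa [word_exch_left hk, word_exch_right hk]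

theorem missing_of_kill {c : Rook n} (h : c.word 0 ≠ 0) : (killFirst c).Missing (c.word 0) := by
  refine ⟨by omega, c.word_le 0, fun i hi => ?_⟩
  rw [word_killFirst] at hi
  split_ifs at hi with h0
  · exact h hi.symm
  · exact h0 (word_inj (r := c) (by omega) hi)

/-- A missing letter may be put in place of a leading zero. -/
theorem exists_fill {z : Rook n} {a : ℕ} (h0 : z.word 0 = 0) (ha : z.Missing a) :
    ∃ c : Rook n, c.word 0 = a ∧ killFirst c = z := by
  obtain ⟨ha0, han, ha⟩ := ha
  have hn : 0 < n := by omega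
  let c : Rook n :=
    { letter := fun i => if (i : ℕ) = 0 then ⟨a, by omega⟩ else z.letter i
      inj := fun i j hi hij => by
        have hai : ∀ i : Fin n, (⟨a, by omega⟩ : Fin (n + 1)) ≠ z.letter i := fun i h => by
          refine ha i ?_
          rw [word_of_lt _ i.2, Fin.eta, ← h]
        split_ifs at hi hij with h1 h2 h2
        · exact Fin.ext (h1.trans h2.symm)
        · exact absurd hij (hai j)
        · exact absurd hij.symm (hai i)
        · exact z.inj i j hi hij }
  have hc : ∀ i, c.word i = if i = 0 then a else z.word i := fun i => by
    by_cases hi : i < n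
    · rw [word_of_lt _ hi, word_of_lt _ hi]
      simp only [c]
      split_ifs <;> rfl
    · rw [word_of_le _ (not_lt.1 hi), word_of_le _ (not_lt.1 hi), if_neg (by omega)]
  refine ⟨c, by rw [hc, if_pos rfl], ext_word fun i => ?_⟩
  rw [word_killFirst, hc]
  split_ifs with hi
  · rw [hi, h0]
  · rfl

theorem eq_of_killFirst_eq {c d : Rook n} (h : killFirst c = killFirst d)
    (h0 : c.word 0 = d.word 0) : c = d := by
  refine ext_word fun i => ?_
  have := congrArg (fun r => word r i) h
  simp only [word_killFirst] at this
  split_ifs at this with hi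
  · rwa [hi]
  · exact this

/-- If the first letter is `0`, only `n - 1` positions are left for the `n` nonzero letters. -/
theorem exists_missing {z : Rook n} (hn : 0 < n) (h0 : z.word 0 = 0) : ∃ a, z.Missing a := by
  by_contra! h
  have hsub : Finset.Icc 1 n ⊆ (Finset.Ico 1 n).image z.word := fun a ha => by
    rw [Finset.mem_Icc] at ha
    have := h a
    simp only [Missing, not_and, not_forall, not_not] at this
    obtain ⟨i, hi⟩ := this (by omega) ha.2
    refine Finset.mem_image.2
      ⟨i, Finset.mem_Ico.2 ⟨?_, lt_of_word_ne_zero (r := z) (by omega)⟩, hi⟩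
    by_contra hi0
    rw [show i = 0 by omega] at hi
    omega
  have := (Finset.card_le_card hsub).trans Finset.card_image_le
  simp only [Nat.card_Icc, Nat.card_Ico] at this
  omega

/-- If a step from `c₁` and a step from `c₂ ≠ c₁` both lead to `z`, then `z` is the meet of `c₁` and
`c₂`: because `w ≤ c₂`, the invariant permits the step from `c₁` to `z`. -/
theorem le_of_le_of_le {z c₁ c₂ w : Rook n} (h₁ : Step c₁ z) (h₂ : Step c₂ z) (hne : c₁ ≠ c₂)
    (hw₁ : w ≤ c₁) (hw₂ : w ≤ c₂) : w ≤ z := by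
  cases h₁ with
  | exch k h =>
    have hk := lt_of_ascent h
    refine (le_of_step_all c₁ w hw₁).1 k ⟨h, fun i hi => ?_⟩
    -- In `c₂`, as in `z`, the larger letter still precedes the smaller one.
    obtain ⟨j, hj, hj'⟩ : ∃ j, c₂.word j = c₁.word (k + 1) ∧
        (exch k c₁).after k (c₁.word k) ≤ c₂.after j (c₁.word k) := by
      have e0 := word_exch_left hk c₁
      generalize hz : exch k c₁ = z at *
      cases h₂ with
      | exch k' h' =>
        have hk' := lt_of_ascent h'
        have hkk' : k ≠ k' := by
          rintro rfl
          exact hne (by rw [← exch_exch k c₁, hz, exch_exch])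
        by_cases hkk : k = k' + 1
        · subst hkk
          refine ⟨k', ?_, ?_⟩
          · rw [← e0, word_exch_right hk']
          · rw [after_exch hk' c₂ (by omega)]
            exact c₂.after_anti (Nat.le_succ k') _
        · refine ⟨k, ?_, ?_⟩
          · rw [← e0, word_exch_of_ne hk' c₂ hkk' hkk]
          · rw [after_exch hk' c₂ hkk']
      | kill h' =>
        rw [word_killFirst] at e0
        split_ifs at e0
        · omega
        · exact ⟨k, e0, (after_killFirst _ _ _).le⟩
    have h1 := after_eq_succ (exch k c₁) hk (c₁.word k)
    rw [if_pos (word_exch_right hk c₁), after_exch hk c₁ (i := k + 1) (by omega)] at h1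
    have h2 := after_le_after hw₂ (hi.trans hj.symm) (a := c₁.word k) (by omega)
    omega
  | kill h =>
    refine (le_of_step_all c₁ w hw₁).2 fun i hi hi' => ?_
    obtain ⟨j, hj, -⟩ := exists_word_eq hw₂ hi
    have hm := (missing_of_kill h).2.2
    rw [hi'] at hj
    generalize hz : killFirst c₁ = z at *
    cases h₂ with
    | exch k h' =>
      have hk := lt_of_ascent h'
      by_cases h1 : j = k
      · exact hm (k + 1) (by rw [word_exch_right hk, ← h1, hj])
      by_cases h2 : j = k + 1
      · exact hm k (by rw [word_exch_left hk, ← h2, hj])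
      · exact hm j (by rw [word_exch_of_ne hk _ h1 h2, hj])
    | kill h' =>
      by_cases h1 : j = 0
      · subst h1
        exact hne (eq_of_killFirst_eq hz hj.symm)
      · exact hm j (by rw [word_killFirst, if_neg h1, hj])

theorem exists_step_le {z x : Rook n} (h : z < x) : ∃ c, Step c z ∧ c ≤ x := by
  rcases (le_iff_reflTransGen.1 h.le).cases_tail with rfl | ⟨c, hc, hs⟩
  · exact absurd h (lt_irrefl _)
  · exact ⟨c, hs, le_iff_reflTransGen.2 hc⟩

theorem meetIrreducible_iff_existsUnique_step {z : Rook n} :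
    MeetIrreducible z ↔ ∃! c, Step c z := by
  constructor
  · rintro ⟨hmax, hz⟩
    rw [not_isMax_iff] at hmax
    obtain ⟨x, hx⟩ := hmax
    obtain ⟨c, hc, -⟩ := exists_step_le hx
    refine ⟨c, hc, fun d hd => ?_⟩
    by_contra hne
    have hglb : IsGLB {d, c} z := by
      refine ⟨?_, fun w hw => le_of_le_of_le hd hc hne (hw (by simp)) (hw (by simp))⟩
      rintro y (rfl | rfl)
      exacts [hd.lt.le, hc.lt.le]
    rcases hz d c hglb with rfl | rfl
    exacts [lt_irrefl _ hd.lt, lt_irrefl _ hc.lt]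
  · rintro ⟨c, hc, huniq⟩
    refine ⟨not_isMax_iff.2 ⟨c, hc.lt⟩, fun x y hxy => ?_⟩
    by_contra! hne
    obtain ⟨d, hd, hdx⟩ := exists_step_le (lt_of_le_of_ne (hxy.1 (by simp)) hne.1.symm)
    obtain ⟨e, he, hey⟩ := exists_step_le (lt_of_le_of_ne (hxy.1 (by simp)) hne.2.symm)
    rw [huniq d hd] at hdx
    rw [huniq e he] at hey
    refine hc.lt.not_ge (hxy.2 ?_)
    rintro w (rfl | rfl)
    exacts [hdx, hey]

theorem exch_injOn_descent {z : Rook n} {j k : ℕ} (hj : z.Descent j) (hk : z.Descent k)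
    (h : exch j z = exch k z) : j = k := by
  by_contra hne
  have h1 := congrArg (fun r => word r j) h
  simp only [word_exch hj.1, word_exch hk.1] at h1
  have := hj.2
  have := hk.2
  grind

theorem meetIrreducible_iff {z : Rook n} :
    MeetIrreducible z ↔ (z.word 0 ≠ 0 ∧ ∃! k, z.Descent k) ∨
      (z.word 0 = 0 ∧ (∀ k, ¬ z.Descent k) ∧ ∃! a, z.Missing a) := by
  rw [meetIrreducible_iff_existsUnique_step]
  constructor
  · rintro ⟨c, hc, huniq⟩
    by_cases h0 : z.word 0 = 0
    · refine Or.inr ⟨h0, ?_⟩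
      have hfill : ∀ a, z.Missing a → c.word 0 = a := fun a ha => by
        obtain ⟨d, hd, rfl⟩ := exists_fill h0 ha
        rw [← huniq d (Step.kill d (by rw [hd]; exact ha.1.ne')), hd]
      have hdesc : ∀ k, ¬ z.Descent k := fun k hk => by
        obtain ⟨a, ha⟩ := exists_missing (by have := hk.1; omega) h0
        have h1 := hfill a ha
        have hk2 := hk.2
        have hk0 : 0 ≠ k := by
          rintro rfl
          omega
        rw [← huniq _ (step_exch_of_descent hk), word_exch_of_ne hk.1 _ hk0 (by omega), h0] at h1
        exact ha.1.ne h1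
      refine ⟨hdesc, c.word 0, ?_, fun a ha => (hfill a ha).symm⟩
      cases hc with
      | exch k h => exact absurd (descent_of_ascent h) (hdesc k)
      | kill h => exact missing_of_kill h
    · refine Or.inl ⟨h0, ?_⟩
      cases hc with
      | exch k h =>
        refine ⟨k, descent_of_ascent h, fun j hj => ?_⟩
        refine exch_injOn_descent hj (descent_of_ascent h) ?_
        rw [huniq _ (step_exch_of_descent hj), exch_exch]
      | kill h => exact absurd (by rw [word_killFirst, if_pos rfl]) h0
  · rintro (⟨h0, k, hk, huniq⟩ | ⟨h0, hdesc, a, ha, huniq⟩)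
    · refine ⟨exch k z, step_exch_of_descent hk, fun c hc => ?_⟩
      cases hc with
      | exch j h =>
        rw [← huniq j (descent_of_ascent h), exch_exch]
      | kill h => exact absurd (by rw [word_killFirst, if_pos rfl]) h0
    · obtain ⟨d, hd, rfl⟩ := exists_fill h0 ha
      refine ⟨d, Step.kill d (by rw [hd]; exact ha.1.ne'), fun c hc => ?_⟩
      generalize hz : killFirst d = z at *
      cases hc with
      | exch j h => exact absurd (descent_of_ascent h) (hdesc j)
      | kill h =>
        exact eq_of_killFirst_eq hz.symm ((huniq _ (missing_of_kill h)).trans hd.symm)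

/-! ### Words with two runs -/

/-- The pair of `z` and a cutting position `d` is a two-run word: the letters before position `d`
are nonzero, and the word goes down at most at the cut. Either run may be empty, and a word without
descents may be cut at several places. -/
structure TwoRuns (z : Rook n) (d : ℕ) : Prop where
  le : d ≤ n
  ne_zero : ∀ j < d, z.word j ≠ 0
  descent : ∀ j, z.Descent j → j + 1 = d

open Classical in
/-- The distribution of the letters `1, …, n` (the letter `a + 1` being represented by `a`) for a
word cut at `d`: class `0` if the letter occurs before the cut, class `2` if it occurs after the
cut, class `1` if it is missing. -/
noncomputable def distr (z : Rook n) (d : ℕ) (a : Fin n) : Fin 3 :=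
  if ∃ j < d, z.word j = a + 1 then 0 else if ∃ j, z.word j = a + 1 then 2 else 1

theorem distr_eq_zero_iff {z : Rook n} {d : ℕ} {a : Fin n} :
    z.distr d a = 0 ↔ ∃ j < d, z.word j = a + 1 := by
  rw [distr]
  split_ifs with h1 h2 <;> simp [h1]

theorem distr_eq_two_iff {z : Rook n} {d : ℕ} {a : Fin n} :
    z.distr d a = 2 ↔ ∃ j, d ≤ j ∧ z.word j = a + 1 := by
  rw [distr]
  split_ifs with h1 h2
  · simp only [Fin.isValue, Fin.reduceEq, false_iff, not_exists, not_and]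
    intro j hj e
    obtain ⟨l, hl, e'⟩ := h1
    have := word_inj (r := z) (i := j) (j := l) (by omega) (by omega)
    omega
  · obtain ⟨j, hj⟩ := h2
    simp only [true_iff]
    exact ⟨j, not_lt.1 fun h => h1 ⟨j, h, hj⟩, hj⟩
  · simp only [Fin.isValue, Fin.reduceEq, false_iff, not_exists, not_and]
    exact fun j _ e => h2 ⟨j, e⟩

theorem word_lt_word_of_forall {z : Rook n} {i j : ℕ} (hij : i < j) (hj : j < n)
    (h0 : z.word i ≠ 0) (h : ∀ l, i ≤ l → l < j → ¬ z.Descent l) : z.word i < z.word j := by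
  induction j, hij using Nat.le_induction with
  | base =>
    have h1 : ¬ z.word (i + 1) < z.word i := fun h' => h i le_rfl (Nat.lt_succ_self i) ⟨hj, h'⟩
    have h2 : z.word i ≠ z.word (i + 1) := fun e => by
      have := word_inj h0 e
      omega
    simp only [Nat.succ_eq_add_one]
    omega
  | succ j hij ih =>
    have h1 := ih (by omega) fun l h1 h2 => h l h1 (by omega)
    have h2 : ¬ z.word (j + 1) < z.word j :=
      fun h' => h j (Nat.le_of_lt hij) (Nat.lt_succ_self j) ⟨hj, h'⟩
    omega

theorem TwoRuns.lt_left {z : Rook n} {d : ℕ} (h : TwoRuns z d) {i j : ℕ} (hij : i < j)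
    (hj : j < d) : z.word i < z.word j := by
  have := h.le
  refine word_lt_word_of_forall hij (by omega) (h.ne_zero i (by omega)) fun l _ h2 h3 => ?_
  have := h.descent l h3
  omega

theorem TwoRuns.lt_right {z : Rook n} {d : ℕ} (h : TwoRuns z d) {i j : ℕ} (hi : d ≤ i)
    (hij : i < j) (hj : j < n) (h0 : z.word i ≠ 0) : z.word i < z.word j := by
  refine word_lt_word_of_forall hij hj h0 fun l _ h2 h3 => ?_
  have := h.descent l h3
  omega

/-- A letter of the first run stands at the position given by the number of smaller letters of that
run. -/
theorem TwoRuns.card_left {z : Rook n} {d : ℕ} (h : TwoRuns z d) {j : ℕ} {a : Fin n}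
    (hj : j < d) (ha : z.word j = a + 1) :
    (Finset.univ.filter fun b => b < a ∧ z.distr d b = 0).card = j := by
  have hle := h.le
  conv_rhs => rw [← Finset.card_range j]
  symm
  refine Finset.card_bij (fun i hi => ⟨z.word i - 1, ?_⟩) (fun i hi => ?_) (fun i hi l hl e => ?_)
    fun b hb => ?_
  · have := z.word_le i
    have := a.2
    omega
  · rw [Finset.mem_range] at hi
    have h1 := h.lt_left hi hj
    have h2 := h.ne_zero i (by omega)
    simp only [Finset.mem_filter, Finset.mem_univ, true_and, Fin.lt_def, distr_eq_zero_iff]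
    exact ⟨by omega, i, by omega, by omega⟩
  · rw [Finset.mem_range] at hi hl
    have h1 := h.ne_zero i (by omega)
    have h2 := h.ne_zero l (by omega)
    simp only [Fin.mk.injEq] at e
    exact word_inj h1 (by omega)
  · simp only [Finset.mem_filter, Finset.mem_univ, true_and, Fin.lt_def, distr_eq_zero_iff] at hb
    obtain ⟨hba, i, hi, hib⟩ := hb
    refine ⟨i, ?_, Fin.ext ?_⟩
    · rw [Finset.mem_range]
      by_contra! hji
      rcases hji.eq_or_lt with rfl | hji
      · omega
      · have := h.lt_left hji hi
        omega
    · simp only [hib, Nat.add_sub_cancel]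

/-- A letter of the second run stands at the position given by the number of larger letters of that
run. -/
theorem TwoRuns.card_right {z : Rook n} {d : ℕ} (h : TwoRuns z d) {j : ℕ} {a : Fin n}
    (hj : d ≤ j) (ha : z.word j = a + 1) :
    (Finset.univ.filter fun b => a < b ∧ z.distr d b = 2).card = n - 1 - j := by
  have hjn := lt_of_word_ne_zero (r := z) (i := j) (by omega)
  have e : n - 1 - j = (Finset.Ioo j n).card := by
    rw [Nat.card_Ioo]
    omega
  rw [e]
  symm
  refine Finset.card_bij (fun i hi => ⟨z.word i - 1, ?_⟩) (fun i hi => ?_) (fun i hi l hl e => ?_)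
    fun b hb => ?_
  · have := z.word_le i
    omega
  · rw [Finset.mem_Ioo] at hi
    have h1 := h.lt_right hj hi.1 hi.2 (by omega)
    simp only [Finset.mem_filter, Finset.mem_univ, true_and, Fin.lt_def, distr_eq_two_iff]
    exact ⟨by omega, i, by omega, by omega⟩
  · rw [Finset.mem_Ioo] at hi hl
    have h1 := h.lt_right hj hi.1 hi.2 (by omega)
    have h2 := h.lt_right hj hl.1 hl.2 (by omega)
    simp only [Fin.mk.injEq] at e
    exact word_inj (r := z) (by omega) (by omega)
  · simp only [Finset.mem_filter, Finset.mem_univ, true_and, Fin.lt_def, distr_eq_two_iff] at hb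
    obtain ⟨hba, i, hi, hib⟩ := hb
    refine ⟨i, ?_, Fin.ext ?_⟩
    · have hin := lt_of_word_ne_zero (r := z) (i := i) (by omega)
      rw [Finset.mem_Ioo]
      refine ⟨?_, hin⟩
      by_contra! hji
      rcases hji.eq_or_lt with rfl | hji
      · omega
      · have := h.lt_right hi hji hjn (by omega)
        omega
    · simp only [hib, Nat.add_sub_cancel]

theorem TwoRuns.word_eq {z z' : Rook n} {d d' : ℕ} (h : TwoRuns z d) (h' : TwoRuns z' d')
    (e : z.distr d = z'.distr d') {j : ℕ} (hj : z.word j ≠ 0) : z'.word j = z.word j := by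
  have hn := z.word_le j
  obtain ⟨a, ha⟩ : ∃ a : Fin n, z.word j = a + 1 :=
    ⟨⟨z.word j - 1, by omega⟩, by simp only; omega⟩
  have hjn := lt_of_word_ne_zero hj
  rcases lt_or_ge j d with hjd | hjd
  · have h1 := distr_eq_zero_iff.2 ⟨j, hjd, ha⟩
    rw [e, distr_eq_zero_iff] at h1
    obtain ⟨l, hl, hla⟩ := h1
    have h2 := h'.card_left hl hla
    rw [← e, h.card_left hjd ha] at h2
    rw [ha, h2, hla]
  · have h1 := distr_eq_two_iff.2 ⟨j, hjd, ha⟩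
    rw [e, distr_eq_two_iff] at h1
    obtain ⟨l, hl, hla⟩ := h1
    have h2 := h'.card_right hl hla
    have hln := lt_of_word_ne_zero (r := z') (i := l) (by omega)
    rw [← e, h.card_right hjd ha] at h2
    rw [show j = l by omega] at ha ⊢
    rw [hla, ha]

theorem TwoRuns.cut_le {z : Rook n} {d d' : ℕ} (h : TwoRuns z d) (e : z.distr d = z.distr d') :
    d ≤ d' := by
  by_contra! hd
  have h0 := h.ne_zero d' hd
  have hn := z.word_le d'
  have h1 := (distr_eq_zero_iff (z := z) (d := d) (a := ⟨z.word d' - 1, by omega⟩)).2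
    ⟨d', hd, by simp only; omega⟩
  rw [e, distr_eq_zero_iff] at h1
  obtain ⟨j, hj, hj'⟩ := h1
  simp only at hj'
  have := word_inj h0 (j := j) (by omega)
  omega

/-- A two-run word and its cut are determined by the distribution of the letters. -/
theorem TwoRuns.eq_of_distr_eq {z z' : Rook n} {d d' : ℕ} (h : TwoRuns z d) (h' : TwoRuns z' d')
    (e : z.distr d = z'.distr d') : z = z' ∧ d = d' := by
  have hz : z = z' := by
    refine ext_word fun j => ?_
    by_cases hj : z.word j = 0
    · by_contra hne
      exact hne (h'.word_eq h e.symm (by omega))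
    · exact (h.word_eq h' e hj).symm
  subst hz
  exact ⟨rfl, (h.cut_le e).antisymm (h'.cut_le e.symm)⟩

/-- Every distribution of the letters comes from a two-run word: sort the letters by class and then
by value, and erase the letters of class `1`. -/
theorem exists_twoRuns (f : Fin n → Fin 3) :
    ∃ (z : Rook n) (d : ℕ), TwoRuns z d ∧ z.distr d = f := by
  -- Since the values are less than `n`, comparing `κ` is comparing first classes, then values.
  let κ : Fin n → ℕ := fun a => n * (f a : ℕ) + a
  let σ := Tuple.sort κ
  have hκ : ∀ i j, i ≤ j → κ (σ i) ≤ κ (σ j) := fun i j h => Tuple.monotone_sort κ h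
  have hcls : ∀ i j, i ≤ j → f (σ i) ≤ f (σ j) := fun i j h => by
    by_contra! hlt
    have h1 : n * (f (σ j) : ℕ) + (σ j : ℕ) ≥ n * (f (σ i) : ℕ) + (σ i : ℕ) := hκ i j h
    have h2 : n * ((f (σ j) : ℕ) + 1) ≤ n * (f (σ i) : ℕ) := Nat.mul_le_mul_left _ hlt
    have := (σ j).2
    rw [mul_add] at h2
    omega
  let z : Rook n :=
    { letter := fun j => if f (σ j) = 1 then 0 else (σ j).succ
      inj := fun i j hi hij => by
        split_ifs at hi hij with h1 h2 h2
        · exact absurd rfl hi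
        · exact absurd rfl hi
        · exact absurd hij (Fin.succ_ne_zero _)
        · exact σ.injective (Fin.succ_injective _ hij) }
  have hz : ∀ j (hj : j < n), z.word j = if f (σ ⟨j, hj⟩) = 1 then 0 else (σ ⟨j, hj⟩ : ℕ) + 1 := by
    intro j hj
    rw [word_of_lt _ hj]
    simp only [z]
    split_ifs <;> simp
  obtain ⟨d, hd, hd0⟩ : ∃ d ≤ n, ∀ j (hj : j < n), f (σ ⟨j, hj⟩) = 0 ↔ j < d := by
    obtain ⟨d, hd, hmin⟩ : ∃ d, (¬ ∃ h : d < n, f (σ ⟨d, h⟩) = 0) ∧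
        ∀ m < d, ∃ h : m < n, f (σ ⟨m, h⟩) = 0 := by
      classical
      have hex : ∃ m, ¬ ∃ h : m < n, f (σ ⟨m, h⟩) = 0 := ⟨n, fun ⟨h, _⟩ => lt_irrefl n h⟩
      exact ⟨Nat.find hex, Nat.find_spec hex, fun m hm => not_not.1 (Nat.find_min hex hm)⟩
    refine ⟨d, ?_, fun j hj => ⟨fun h => ?_, fun h => (hmin j h).2⟩⟩
    · by_contra! hnd
      exact lt_irrefl n (hmin n hnd).1
    · by_contra! hle
      have h1 := hcls ⟨d, by omega⟩ ⟨j, hj⟩ hle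
      rw [h] at h1
      exact hd ⟨by omega, le_antisymm h1 (Fin.zero_le _)⟩
  have hword : ∀ a j, z.word j = (a : Fin n) + 1 ↔ ∃ hj : j < n, σ ⟨j, hj⟩ = a ∧ f a ≠ 1 := by
    intro a j
    constructor
    · intro h
      have hj := lt_of_word_ne_zero (r := z) (i := j) (by omega)
      rw [hz j hj] at h
      split_ifs at h with h1
      have : σ ⟨j, hj⟩ = a := Fin.ext (by omega)
      exact ⟨hj, this, this ▸ h1⟩
    · rintro ⟨hj, rfl, h⟩
      rw [hz j hj, if_neg h]
  refine ⟨z, d, ⟨hd, fun j hj => ?_, fun j hj => ?_⟩, funext fun a => ?_⟩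
  · have h := (hd0 j (by omega)).2 hj
    rw [hz j (by omega), if_neg (by rw [h]; decide)]
    omega
  · obtain ⟨hjn, hj⟩ := hj
    rw [hz j (by omega), hz (j + 1) hjn] at hj
    have h1 := hcls ⟨j, by omega⟩ ⟨j + 1, hjn⟩ (by simp)
    have h2 : n * (f (σ ⟨j, _⟩) : ℕ) + (σ ⟨j, _⟩ : ℕ) ≤
      n * (f (σ ⟨j + 1, _⟩) : ℕ) + (σ ⟨j + 1, hjn⟩ : ℕ) :=
        hκ ⟨j, by omega⟩ ⟨j + 1, hjn⟩ (by simp)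
    have h3 := hd0 j (by omega)
    have h4 := hd0 (j + 1) hjn
    rcases h1.eq_or_lt with h5 | h5
    · rw [h5] at hj h2
      split_ifs at hj <;> omega
    · have h6 : f (σ ⟨j, by omega⟩) ≠ 1 := fun h => by
        rw [if_pos h] at hj
        omega
      have h7 : f (σ ⟨j, by omega⟩) = 0 := by omega
      have h8 : f (σ ⟨j + 1, hjn⟩) ≠ 0 := by omega
      have h9 := h3.1 h7
      have h10 := fun h => h8 (h4.2 h)
      omega
  · have hσ : σ ⟨σ.symm a, (σ.symm a).2⟩ = a := by simp
    have h1 := hd0 (σ.symm a) (σ.symm a).2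
    rw [hσ] at h1
    obtain h | h | h : f a = 0 ∨ f a = 1 ∨ f a = 2 := by omega
    · rw [h, distr_eq_zero_iff]
      exact ⟨σ.symm a, h1.1 h, (hword _ _).2 ⟨_, hσ, by rw [h]; decide⟩⟩
    · have h2 : ∀ j, z.word j ≠ a + 1 := fun j hj => by
        obtain ⟨_, _, h'⟩ := (hword _ _).1 hj
        exact h' h
      rw [distr, if_neg (fun ⟨j, _, hj⟩ => h2 j hj), if_neg (fun ⟨j, hj⟩ => h2 j hj), h]
    · rw [h, distr_eq_two_iff]
      refine ⟨σ.symm a, not_lt.1 fun h' => ?_, (hword _ _).2 ⟨_, hσ, by rw [h]; decide⟩⟩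
      rw [h1.2 h'] at h
      exact absurd h (by decide)

/-! ### Counting -/

theorem p_eq (hn : 0 < n) (z : Rook n) : p hn z = if z.word 0 = 0 then 1 else z.word 0 := by
  rw [p, word_of_lt z hn]
  simp only [Fin.ext_iff, Fin.val_zero]

/-- The identity rook `1 2 ⋯ n`. -/
def ident (n : ℕ) : Rook n where
  letter := Fin.succ
  inj _ _ _ h := Fin.succ_injective _ h

theorem word_ident {j : ℕ} (hj : j < n) : (ident n).word j = j + 1 := by
  rw [word_of_lt _ hj]
  rfl

theorem not_descent_ident (k : ℕ) : ¬ (ident n).Descent k := fun ⟨h1, h2⟩ => by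
  rw [word_ident h1, word_ident (by omega)] at h2
  omega

/-- A word without descents and without zeros is strictly increasing with letters in `1, …, n`, so
it is the identity. -/
theorem eq_ident {z : Rook n} (h0 : z.word 0 ≠ 0) (h : ∀ k, ¬ z.Descent k) : z = ident n := by
  have hpos : ∀ j < n, z.word j ≠ 0 := fun j hj => by
    rcases Nat.eq_zero_or_pos j with rfl | hj0
    · exact h0
    · have := word_lt_word_of_forall hj0 hj h0 fun l _ _ => h l
      omega
  have hadd : ∀ j m, j + m < n → z.word j + m ≤ z.word (j + m) := fun j m => by
    induction m with
    | zero => simp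
    | succ m ih =>
      intro hm
      have h1 := ih (by omega)
      have h2 := word_lt_word_of_forall (Nat.lt_succ_self (j + m)) hm (hpos _ (by omega))
        fun l _ _ => h l
      simp only [Nat.succ_eq_add_one] at h2
      rw [← add_assoc j m 1]
      omega
  refine ext_word fun j => ?_
  by_cases hj : j < n
  · have h1 := hadd 0 j (by omega)
    have h2 := hadd j (n - 1 - j) (by omega)
    have h3 := z.word_le (j + (n - 1 - j))
    rw [zero_add] at h1
    rw [word_ident hj]
    omega
  · rw [word_of_le _ (not_lt.1 hj), word_of_le _ (not_lt.1 hj)]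

/-- The distribution of the letters in the identity rook cut at `a`. -/
def initialDistr (n a : ℕ) (b : Fin n) : Fin 3 := if (b : ℕ) + 1 ≤ a then 0 else 2

theorem twoRuns_ident {a : ℕ} (ha : a ≤ n) : TwoRuns (ident n) a where
  le := ha
  ne_zero j hj := by
    rw [word_ident (by omega)]
    omega
  descent j hj := absurd hj (not_descent_ident j)

theorem distr_ident (a : ℕ) : (ident n).distr a = initialDistr n a := by
  funext b
  have hb := word_ident b.2
  rw [initialDistr]
  split_ifs with h
  · exact distr_eq_zero_iff.2 ⟨b, by omega, hb⟩
  · exact distr_eq_two_iff.2 ⟨b, by omega, hb⟩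

theorem initialDistr_inj {a a' : ℕ} (ha : a ≤ n) (ha' : a' ≤ n)
    (h : initialDistr n a = initialDistr n a') : a = a' := by
  rw [← distr_ident, ← distr_ident] at h
  exact ((twoRuns_ident ha).eq_of_distr_eq (twoRuns_ident ha') h).2

theorem twoRuns_zero {z : Rook n} (h : ∀ k, ¬ z.Descent k) : TwoRuns z 0 :=
  ⟨n.zero_le, fun j hj => absurd hj (Nat.not_lt_zero j), fun j hj => absurd hj (h j)⟩

theorem distr_zero_of_missing {z : Rook n} {a : ℕ} (ha : z.Missing a)
    (huniq : ∀ b, z.Missing b → b = a) :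
    z.distr 0 = fun b : Fin n => if (b : ℕ) + 1 = a then 1 else 2 := by
  funext b
  rw [distr, if_neg (by simp)]
  by_cases hb : (b : ℕ) + 1 = a
  · rw [if_neg (by rw [hb]; exact fun ⟨j, hj⟩ => ha.2.2 j hj), if_pos hb]
  · rw [if_pos, if_neg hb]
    by_contra! h
    exact hb (huniq _ ⟨by omega, b.2, h⟩)

theorem twoRuns_of_unique_descent {z : Rook n} {k : ℕ} (h0 : z.word 0 ≠ 0) (hk : z.Descent k)
    (huniq : ∀ j, z.Descent j → j = k) : TwoRuns z (k + 1) where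
  le := hk.1.le
  ne_zero j hj := by
    rcases Nat.eq_zero_or_pos j with rfl | hj0
    · exact h0
    · have hkn := hk.1
      have := word_lt_word_of_forall hj0 (by omega) h0 fun l _ h2 h3 => by
        have := huniq l h3
        omega
      omega
  descent j hj := by rw [huniq j hj]

open Classical in
/-- The distribution of letters attached to a meet irreducible rook. A rook with a descent is cut
at it; a rook without descents that misses the letter `a` is sent to the distribution of the
identity rook cut at `a`, which no rook with a descent attains. -/
noncomputable def code (z : Rook n) : Fin n → Fin 3 :=
  if h : ∃ k, z.Descent k then z.distr (h.choose + 1)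
  else if h : ∃ a, z.Missing a then initialDistr n h.choose
  else fun _ => 0

theorem code_of_descent {z : Rook n} {k : ℕ} (hk : z.Descent k)
    (huniq : ∀ j, z.Descent j → j = k) : z.code = z.distr (k + 1) := by
  have h : ∃ k, z.Descent k := ⟨k, hk⟩
  rw [code, dif_pos h, huniq _ h.choose_spec]

theorem code_of_missing {z : Rook n} {a : ℕ} (h : ∀ k, ¬ z.Descent k) (ha : z.Missing a)
    (huniq : ∀ b, z.Missing b → b = a) : z.code = initialDistr n a := by
  have h' : ∃ a, z.Missing a := ⟨a, ha⟩
  rw [code, dif_neg (not_exists.2 h), dif_pos h', huniq _ h'.choose_spec]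

theorem injOn_code : Set.InjOn (code : Rook n → Fin n → Fin 3) {z | MeetIrreducible z} := by
  -- A two-run word with a descent is not the identity rook.
  have key : ∀ (z : Rook n) (k a : ℕ), z.word 0 ≠ 0 → z.Descent k → (∀ j, z.Descent j → j = k) →
      a ≤ n → z.distr (k + 1) ≠ initialDistr n a := fun z k a h0 hk hu ha e => by
    rw [← distr_ident] at e
    have := ((twoRuns_of_unique_descent h0 hk hu).eq_of_distr_eq (twoRuns_ident ha) e).1
    exact not_descent_ident k (this ▸ hk)
  intro z hz z' hz' e
  rw [Set.mem_ofPred_eq, meetIrreducible_iff] at hz hz'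
  rcases hz with ⟨h0, k, hk, hu⟩ | ⟨h0, hd, a, ha, hu⟩ <;>
    rcases hz' with ⟨h0', k', hk', hu'⟩ | ⟨h0', hd', a', ha', hu'⟩
  · rw [code_of_descent hk hu, code_of_descent hk' hu'] at e
    exact ((twoRuns_of_unique_descent h0 hk hu).eq_of_distr_eq
      (twoRuns_of_unique_descent h0' hk' hu') e).1
  · rw [code_of_descent hk hu, code_of_missing hd' ha' hu'] at e
    exact absurd e (key z k a' h0 hk hu ha'.2.1)
  · rw [code_of_missing hd ha hu, code_of_descent hk' hu'] at e
    exact absurd e.symm (key z' k' a h0' hk' hu' ha.2.1)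
  · rw [code_of_missing hd ha hu, code_of_missing hd' ha' hu'] at e
    obtain rfl := initialDistr_inj ha.2.1 ha'.2.1 e
    refine ((twoRuns_zero hd).eq_of_distr_eq (twoRuns_zero hd') ?_).1
    rw [distr_zero_of_missing ha hu, distr_zero_of_missing ha' hu']

/-- The distributions in which `i` is the smallest letter of class `0`. -/
def distrsWithMin (n i : ℕ) : Set (Fin n → Fin 3) :=
  {f | ∀ b : Fin n, ((b : ℕ) + 1 < i → f b ≠ 0) ∧ ((b : ℕ) + 1 = i → f b = 0)}

theorem mapsTo_code (hn : 0 < n) (i : ℕ) :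
    Set.MapsTo (code : Rook n → Fin n → Fin 3) {z | MeetIrreducible z ∧ p hn z = i}
      (distrsWithMin n i) := by
  rintro z ⟨hz, hp⟩ b
  rw [p_eq] at hp
  rw [meetIrreducible_iff] at hz
  rcases hz with ⟨h0, k, hk, hu⟩ | ⟨h0, hd, a, ha, hu⟩
  · rw [if_neg h0] at hp
    rw [code_of_descent hk hu, Ne, distr_eq_zero_iff]
    refine ⟨?_, fun h => ⟨0, by omega, by omega⟩⟩
    rintro h ⟨j, hj, hjb⟩
    rcases Nat.eq_zero_or_pos j with rfl | hj0
    · omega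
    · have := (twoRuns_of_unique_descent h0 hk hu).lt_left hj0 hj
      omega
  · rw [if_pos h0] at hp
    rw [code_of_missing hd ha hu, initialDistr]
    refine ⟨fun h => by omega, fun h => ?_⟩
    have := ha.1
    rw [if_pos (by omega)]

/-- An increasing word that begins with `0` and misses exactly the letter `d`. -/
theorem exists_increasing_missing {d : ℕ} (hd0 : 0 < d) (hd : d ≤ n) :
    ∃ z : Rook n, z.word 0 = 0 ∧ (∀ k, ¬ z.Descent k) ∧ z.Missing d ∧
      ∀ b, z.Missing b → b = d := by
  obtain ⟨z, c, hz, hf⟩ :=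
    exists_twoRuns fun b : Fin n => if (b : ℕ) + 1 = d then (1 : Fin 3) else 2
  have hf' := congrFun hf
  obtain rfl : c = 0 := by
    by_contra hc
    have h0 := hz.ne_zero 0 (by omega)
    have hle := z.word_le 0
    have h1 := (distr_eq_zero_iff (z := z) (d := c) (a := ⟨z.word 0 - 1, by omega⟩)).2
      ⟨0, by omega, by simp only; omega⟩
    rw [hf'] at h1
    split_ifs at h1 <;> exact absurd h1 (by decide)
  have hdesc : ∀ k, ¬ z.Descent k := fun k hk => by
    have := hz.descent k hk
    omega
  have hmiss : z.Missing d := by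
    refine ⟨hd0, hd, fun j hj => ?_⟩
    have h1 := (distr_eq_two_iff (z := z) (d := 0) (a := ⟨d - 1, by omega⟩)).2
      ⟨j, j.zero_le, by simp only; omega⟩
    rw [hf', if_pos (by simp only; omega)] at h1
    exact absurd h1 (by decide)
  refine ⟨z, ?_, hdesc, hmiss, fun b hb => ?_⟩
  · by_contra h0
    refine hmiss.2.2 (d - 1) ?_
    rw [eq_ident h0 hdesc, word_ident (by omega)]
    omega
  · obtain ⟨hb0, hbn, hb⟩ := hb
    by_contra hne
    have h1 := hf' ⟨b - 1, by omega⟩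
    rw [if_neg (by simp only; omega), distr_eq_two_iff] at h1
    obtain ⟨j, -, hj⟩ := h1
    exact hb j (by simp only at hj; omega)

theorem surjOn_code (hn : 0 < n) {i : ℕ} (hi : 1 ≤ i) (hin : i ≤ n) :
    Set.SurjOn (code : Rook n → Fin n → Fin 3) {z | MeetIrreducible z ∧ p hn z = i}
      (distrsWithMin n i) := by
  intro f hf
  obtain ⟨z, d, hz, rfl⟩ := exists_twoRuns f
  obtain ⟨j, hj, hji⟩ := distr_eq_zero_iff.1
    ((hf ⟨i - 1, by omega⟩).2 (by simp only; omega))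
  simp only at hji
  have h0 := hz.ne_zero 0 (by omega)
  have hzi : z.word 0 = i := by
    have hle := z.word_le 0
    have h1 := (distr_eq_zero_iff (z := z) (d := d) (a := ⟨z.word 0 - 1, by omega⟩)).2
      ⟨0, by omega, by simp only; omega⟩
    have h2 : ¬ z.word 0 - 1 + 1 < i := fun h => (hf ⟨z.word 0 - 1, by omega⟩).1 h h1
    rcases Nat.eq_zero_or_pos j with rfl | hj0
    · omega
    · have := hz.lt_left hj0 hj
      omega
  by_cases hk : ∃ k, z.Descent k
  · obtain ⟨k, hk⟩ := hk
    obtain rfl := hz.descent k hk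
    have hu : ∀ j, z.Descent j → j = k := fun j hj => by
      have := hz.descent j hj
      omega
    refine ⟨z, ⟨meetIrreducible_iff.2 (Or.inl ⟨h0, k, hk, hu⟩), ?_⟩, code_of_descent hk hu⟩
    rw [p_eq, if_neg h0, hzi]
  · -- The word is the identity rook cut at `d`; the preimage is the rook `0 ⋯` missing `d`.
    rw [not_exists] at hk
    obtain rfl := eq_ident h0 hk
    obtain ⟨y, hy0, hyd, hym, hyu⟩ := exists_increasing_missing (by omega) hz.le
    refine ⟨y, ⟨meetIrreducible_iff.2 (Or.inr ⟨hy0, hyd, d, hym, hyu⟩), ?_⟩, ?_⟩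
    · rw [p_eq, if_pos hy0, ← hzi, word_ident hn]
    · rw [code_of_missing hyd hym hyu, distr_ident]

theorem card_distrsWithMin {i : ℕ} (hi : 1 ≤ i) (hin : i ≤ n) :
    Nat.card (distrsWithMin n i) = 3 ^ (n - i) * 2 ^ (i - 1) := by
  -- Position by position, `t` lists the classes open to the letter `b + 1`.
  let t : ℕ → Finset (Fin 3) := fun b =>
    if b + 1 < i then {1, 2} else if b + 1 = i then {0} else Finset.univ
  have h : distrsWithMin n i =
      (Fintype.piFinset fun b : Fin n => t b : Finset (Fin n → Fin 3)) := by
    ext f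
    simp only [distrsWithMin, Set.mem_ofPred_eq, Finset.mem_coe, Fintype.mem_piFinset, t]
    refine forall_congr' fun b => ?_
    split_ifs with h1 h2
    · have : f b ≠ 0 ↔ f b = 1 ∨ f b = 2 := by omega
      simp [h1, h1.ne, this]
    · simp [h2]
    · simp [h1, h2]
  rw [h, Nat.card_coe_set_eq, Set.ncard_coe_finset, Fintype.card_piFinset,
    Fin.prod_univ_eq_prod_range fun b => (t b).card]
  obtain ⟨m, rfl⟩ : ∃ m, n = (i - 1) + 1 + m := ⟨n - i, by omega⟩
  rw [Finset.prod_range_add, Finset.prod_range_succ]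
  have h1 : ∏ b ∈ Finset.range (i - 1), (t b).card = 2 ^ (i - 1) := by
    rw [Finset.prod_congr rfl (g := fun _ => 2), Finset.prod_const, Finset.card_range]
    intro b hb
    rw [Finset.mem_range] at hb
    simp only [t]
    rw [if_pos (by omega)]
    rfl
  have h2 : (t (i - 1)).card = 1 := by
    simp only [t]
    rw [if_neg (by omega), if_pos (by omega)]
    rfl
  have h3 : ∏ b ∈ Finset.range m, (t (i - 1 + 1 + b)).card = 3 ^ m := by
    rw [Finset.prod_congr rfl (g := fun _ => 3), Finset.prod_const, Finset.card_range]
    intro b _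
    simp only [t]
    rw [if_neg (by omega), if_neg (by omega)]
    rfl
  rw [h1, h2, h3, mul_one, mul_comm]
  congr 2
  omega

theorem card_meetIrreducible_p (hn : 0 < n) {i : ℕ} (hi : 1 ≤ i) (hin : i ≤ n) :
    Nat.card {r : Rook n // MeetIrreducible r ∧ p hn r = i} = 3 ^ (n - i) * 2 ^ (i - 1) := by
  have h : Set.BijOn (code : Rook n → Fin n → Fin 3) {z | MeetIrreducible z ∧ p hn z = i}
      (distrsWithMin n i) :=
    ⟨mapsTo_code hn i, injOn_code.mono fun z hz => hz.1, surjOn_code hn hi hin⟩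
  rw [← card_distrsWithMin hi hin]
  exact Nat.card_congr h.equiv

theorem sum_pow_mul_pow (n : ℕ) :
    ∑ i ∈ Finset.Icc 1 n, 3 ^ (n - i) * 2 ^ (i - 1) = 3 ^ n - 2 ^ n := by
  -- Addition of `2 ^ n` avoids the truncated subtraction.
  suffices h : ∑ i ∈ Finset.Icc 1 n, 3 ^ (n - i) * 2 ^ (i - 1) + 2 ^ n = 3 ^ n by omega
  induction n with
  | zero => simp
  | succ n ih =>
    have h : ∑ i ∈ Finset.Icc 1 n, 3 ^ (n + 1 - i) * 2 ^ (i - 1) =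
        3 * ∑ i ∈ Finset.Icc 1 n, 3 ^ (n - i) * 2 ^ (i - 1) := by
      rw [Finset.mul_sum]
      refine Finset.sum_congr rfl fun i hi => ?_
      rw [Nat.succ_sub (Finset.mem_Icc.1 hi).2, pow_succ]
      ring
    rw [Finset.sum_Icc_succ_top (by omega), h, pow_succ 3 n, ← ih, Nat.sub_self, pow_zero,
      Nat.add_sub_cancel]
    ring

theorem card_meetIrreducible : Nat.card {r : Rook n // MeetIrreducible r} = 3 ^ n - 2 ^ n := by
  classical
  rcases Nat.eq_zero_or_pos n with rfl | hn
  · have : IsEmpty {r : Rook 0 // MeetIrreducible r} := ⟨fun ⟨r, hr, _⟩ => hr fun s _ => by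
      rw [show s = r from Rook.ext (funext fun i => i.elim0)]⟩
    simp
  have := Fintype.ofFinite (Rook n)
  have hmaps : ∀ r ∈ Finset.univ.filter fun r : Rook n => MeetIrreducible r,
      p hn r ∈ Finset.Icc 1 n := fun r _ => by
    have := r.word_le 0
    rw [Finset.mem_Icc, p_eq]
    split_ifs <;> omega
  rw [Nat.card_eq_fintype_card, Fintype.card_subtype, Finset.card_eq_sum_card_fiberwise hmaps,
    ← sum_pow_mul_pow]
  refine Finset.sum_congr rfl fun i hi => ?_
  rw [Finset.mem_Icc] at hi
  rw [← card_meetIrreducible_p hn hi.1 hi.2, Nat.card_eq_fintype_card, Fintype.card_subtype,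
    Finset.filter_filter]

end Rook

theorem mainTheorem5 (n : ℕ) :
    (∀ (hn : 0 < n) (i : ℕ), 1 ≤ i → i ≤ n →
      Nat.card {r : Rook n // MeetIrreducible r ∧ Rook.p hn r = i} = 3 ^ (n - i) * 2 ^ (i - 1)) ∧
    Nat.card {r : Rook n // MeetIrreducible r} = 3 ^ n - 2 ^ n :=
  ⟨fun hn _ hi hin => Rook.card_meetIrreducible_p hn hi hin, Rook.card_meetIrreducible⟩
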